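/- Let $N\ge 3$, let $\Omega\subset\mathbb{R}^N$ be a bounded domain (a nonempty, connected, bounded open set; no regularity of the boundary is needed, so in particular $\Omega$ may be any bounded smooth domain), let $\lambda,\mu\in\mathbb{R}$, and put $2^*=\frac{2N}{N-2}$. Let $H_0^1(\Omega)$ be the closure of $C_c^\infty(\Omega)$ in $H^1(\Omega)$, and let $$\lambda_1(\Omega)=\inf_{v\in H_0^1(\Omega)\setminus\{0\}}\frac{\int_\Omega|\nabla v|^2\,dx}{\int_\Omega v^2\,dx}$$ be the first Dirichlet eigenvalue of $-\Delta$ on $\Omega$. Consider the problem $$-\Delta u=|u|^{2^*-2}u+\lambda u+\mu u\log u^2\ \text{ in }\Omega,\qquad u=0\ \text{ on }\partial\Omega. \tag{1.1}$$ A positive solution of (1.1) is a function $u\in H_0^1(\Omega)$ with $u>0$ almost everywhere in $\Omega$ such that $$\int_\Omega\nabla u\cdot\nabla\varphi\,dx=\int_\Omega\bigl(|u|^{2^*-2}u+\lambda u+\mu u\log u^2\bigr)\varphi\,dx\qquad\text{for all }\varphi\in C_c^\infty(\Omega).$$ **Theorem 1.4.** If $\mu<0$ and $$-\frac{(N-2)\mu}{2}+\frac{(N-2)\mu}{2}\log\Bigl(-\frac{(N-2)\mu}{2}\Bigr)+\lambda-\lambda_1(\Omega)\ge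 0,$$ then problem (1.1) has no positive solution. -/

import Mathlib

open MeasureTheory TopologicalSpace
open scoped Distributions ENNReal

noncomputable section

/-- `G` is the weak gradient of `u` in `Ω`:
`∫_Ω u ∇φ = - ∫_Ω φ G` for every test function `φ ∈ C_c^∞(Ω)`. -/
def HasWeakGradient {N : ℕ} (Ω : Opens (EuclideanSpace ℝ (Fin N)))
    (u : EuclideanSpace ℝ (Fin N) → ℝ)
    (G : EuclideanSpace ℝ (Fin N) → EuclideanSpace ℝ (Fin N)) : Prop :=
  ∀ φ : 𝓓(Ω, ℝ), ∫ x in Ω, u x • gradient φ x = - ∫ x in Ω, φ x • G x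

/-- `u ∈ H¹(Ω)`, with weak gradient `G`. -/
structure MemH1 {N : ℕ} (Ω : Opens (EuclideanSpace ℝ (Fin N)))
    (u : EuclideanSpace ℝ (Fin N) → ℝ)
    (G : EuclideanSpace ℝ (Fin N) → EuclideanSpace ℝ (Fin N)) : Prop where
  memLp : MemLp u 2 (volume.restrict Ω)
  memLp_grad : MemLp G 2 (volume.restrict Ω)
  hasWeakGradient : HasWeakGradient Ω u G

/-- `u ∈ H¹₀(Ω)`, with weak gradient `G`: `u` lies in the closure of `C_c^∞(Ω)` in `H¹(Ω)`. -/
structure MemH10 {N : ℕ} (Ω : Opens (EuclideanSpace ℝ (Fin N)))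
    (u : EuclideanSpace ℝ (Fin N) → ℝ)
    (G : EuclideanSpace ℝ (Fin N) → EuclideanSpace ℝ (Fin N)) : Prop extends MemH1 Ω u G where
  approx : ∀ ε : ℝ≥0∞, 0 < ε → ∃ φ : 𝓓(Ω, ℝ),
    eLpNorm (fun x => u x - φ x) 2 (volume.restrict Ω) ≤ ε ∧
    eLpNorm (fun x => G x - gradient φ x) 2 (volume.restrict Ω) ≤ ε

/-- The first Dirichlet eigenvalue of `-Δ`: the infimum of the Rayleigh quotients
`∫_Ω |∇v|² / ∫_Ω v²` over `v ∈ H¹₀(Ω) \ {0}`. -/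
def firstDirichletEigenvalue {N : ℕ} (Ω : Opens (EuclideanSpace ℝ (Fin N))) : ℝ :=
  sInf {r : ℝ | ∃ v G, MemH10 Ω v G ∧ ¬ (v =ᵐ[volume.restrict Ω] 0) ∧
    r = (∫ x in Ω, ‖G x‖ ^ 2) / ∫ x in Ω, v x ^ 2}

/-- The critical Sobolev exponent `2* = 2N / (N - 2)`. -/
def criticalExponent (N : ℕ) : ℝ := 2 * (N : ℝ) / ((N : ℝ) - 2)

/-- The nonlinearity `|s|^(2* - 2) s + lam s + mu s log s²`
(its last term is `0` at `s = 0`). -/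
def logCriticalNonlinearity (N : ℕ) (lam mu s : ℝ) : ℝ :=
  |s| ^ (criticalExponent N - 2) * s + lam * s + mu * (s * Real.log (s ^ 2))

/-- `u` is a weak solution of the Dirichlet problem
`-Δu = |u|^(2* - 2) u + lam u + mu u log u²` in `Ω`, `u = 0` on `∂Ω`: it lies in `H¹₀(Ω)` and
satisfies the equation against every test function in `C_c^∞(Ω)`. -/
def IsWeakSolution {N : ℕ} (Ω : Opens (EuclideanSpace ℝ (Fin N))) (lam mu : ℝ)
    (u : EuclideanSpace ℝ (Fin N) → ℝ) : Prop :=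
  ∃ G, MemH10 Ω u G ∧ ∀ φ : 𝓓(Ω, ℝ),
    ∫ x in Ω, inner ℝ (G x) (gradient φ x) =
      ∫ x in Ω, logCriticalNonlinearity N lam mu (u x) * φ x

/-- A positive solution: a weak solution with `u > 0` almost everywhere in `Ω`. -/
def IsPositiveSolution {N : ℕ} (Ω : Opens (EuclideanSpace ℝ (Fin N))) (lam mu : ℝ)
    (u : EuclideanSpace ℝ (Fin N) → ℝ) : Prop :=
  IsWeakSolution Ω lam mu u ∧ ∀ᵐ x ∂(volume.restrict (Ω : Set (EuclideanSpace ℝ (Fin N)))), 0 < u x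

end

/-!
Let `u > 0` be a solution with weak gradient `∇u`, write the equation as `-Δu = V(u) u`, and put
`a = -(N-2)μ/2`. The function `V` on `(0, ∞)` has the minimum `a - a log a + λ`, attained only at
`s₀ = a ^ (1 / (2* - 2))`. So the hypothesis says that `V ≥ λ₁`, with `V - λ₁` bounded below by a
positive constant off each neighbourhood of `s₀`. The usual proof tests the equation with the first
eigenfunction. Here no eigenfunction, and hence no compactness, is used: the Dirichlet form is shown
to be bounded below by `λ₁ + κ` on test functions, with some `κ > 0`, which contradicts the
definition of `λ₁` as an infimum.

For a test function `φ`, let `M = ∫ φ²`, `E = ∫ |∇φ|²` and `r = ∇φ - (φ/u) ∇u`.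

* Picone's identity (`MemH10.picone`) gives `∫ V(u) φ² + ∫ |r|² ≤ E`. So `∫ (V(u) - λ₁) φ²`
  and `∫ |r|²` are both at most `E - λ₁ M`. If this excess is small, then `φ²` has little mass where
  `u` is away from `s₀`, and `φ ∇u` is close to `u ∇φ`.
* Testing the equation with `φ² L(u)` and replacing `φ ∇u` by `u ∇φ` gives
  `∫ K'(u) |∇φ|² ≈ ∫ V(u) (K(u)/u) φ²`, where `K(s) = s² L(s)`. For a step `K` of height and width
  of order `δ` at `s₀` this shows that `|∇φ|²` has mass of order `δ E` where `|u - s₀| < δ`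
  (`MemH10.integral_step_le`).
* Poincaré's inequality in the form `M ≤ 2D ∫ |φ| |∇φ|` (`integral_sq_le_integral_mul_gradient`)
  rules out a small excess: where `u` is away from `s₀` the factor `φ` is small in `L²`, and near
  `s₀` the factor `∇φ` is. This is the gap `MemH10.exists_gap`.

Since `u` is only in `H¹₀(Ω)`, the test functions `φ² L(u)` are reached as limits of `φ² L(ψₖ)` with
`ψₖ ∈ C_c^∞(Ω)` converging to `u` (`MemH10.integral_test_sq_mul_comp`). The passage to the limit
needs `V(u) u` to be integrable, which comes from the Sobolev embedding into `L^{2*}`.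
-/

open Filter Topology
open scoped ContDiff

/-! ### Test functions and a Poincaré inequality -/

section TestFunctions

variable {N : ℕ} {Ω : Opens (EuclideanSpace ℝ (Fin N))}

theorem continuous_gradient_testFunction (φ : 𝓓(Ω, ℝ)) : Continuous (gradient φ) := by
  have h : ContDiff ℝ ∞ φ := φ.contDiff
  exact (InnerProductSpace.toDual ℝ _).symm.continuous.comp (h.continuous_fderiv (by simp))

theorem hasCompactSupport_gradient_testFunction (φ : 𝓓(Ω, ℝ)) :
    HasCompactSupport (gradient φ) :=
  (φ.hasCompactSupport.fderiv (𝕜 := ℝ)).comp_left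
    (g := (InnerProductSpace.toDual ℝ (EuclideanSpace ℝ (Fin N))).symm) (map_zero _)

theorem differentiable_testFunction (φ : 𝓓(Ω, ℝ)) : Differentiable ℝ φ := by
  have h : ContDiff ℝ ∞ φ := φ.contDiff
  exact h.differentiable (by simp)

theorem memLp_testFunction (φ : 𝓓(Ω, ℝ)) (p : ℝ≥0∞) : MemLp φ p (volume.restrict Ω) :=
  (φ.continuous.memLp_of_hasCompactSupport φ.hasCompactSupport).restrict _

theorem memLp_gradient_testFunction (φ : 𝓓(Ω, ℝ)) (p : ℝ≥0∞) :
    MemLp (gradient φ) p (volume.restrict Ω) :=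
  ((continuous_gradient_testFunction φ).memLp_of_hasCompactSupport
    (hasCompactSupport_gradient_testFunction φ)).restrict _

theorem exists_bound_testFunction (φ : 𝓓(Ω, ℝ)) :
    ∃ C, 0 ≤ C ∧ ∀ x, |φ x| ≤ C ∧ ‖gradient φ x‖ ≤ C := by
  obtain ⟨A, hA⟩ := φ.continuous.bounded_above_of_compact_support φ.hasCompactSupport
  obtain ⟨B, hB⟩ := (continuous_gradient_testFunction φ).bounded_above_of_compact_support
    (hasCompactSupport_gradient_testFunction φ)
  exact ⟨max A B, ((norm_nonneg _).trans (hA 0)).trans (le_max_left _ _),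
    fun x => ⟨(hA x).trans (le_max_left _ _), (hB x).trans (le_max_right _ _)⟩⟩

/-- The test function `φ² L(ψ)`, for test functions `φ`, `ψ` and a smooth `L : ℝ → ℝ`. -/
noncomputable def sqMulComp (φ ψ : 𝓓(Ω, ℝ)) (L : ℝ → ℝ) (hL : ContDiff ℝ ∞ L) : 𝓓(Ω, ℝ) where
  toFun x := φ x ^ 2 * L (ψ x)
  contDiff' := by
    have h : ContDiff ℝ ∞ φ := φ.contDiff
    have h' : ContDiff ℝ ∞ ψ := ψ.contDiff
    exact (h.pow 2).mul (hL.comp h')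
  hasCompactSupport' := by
    refine φ.hasCompactSupport.mono fun x hx => ?_
    contrapose! hx
    simp only [Function.mem_support, not_not] at hx ⊢
    simp [hx]
  tsupport_subset' := by
    refine (closure_mono fun x hx => ?_).trans φ.tsupport_subset
    contrapose! hx
    simp only [Function.mem_support, not_not] at hx ⊢
    simp [hx]

theorem sqMulComp_apply (φ ψ : 𝓓(Ω, ℝ)) (L : ℝ → ℝ) (hL : ContDiff ℝ ∞ L)
    (x : EuclideanSpace ℝ (Fin N)) : sqMulComp φ ψ L hL x = φ x ^ 2 * L (ψ x) := rfl

theorem inner_gradient_sqMulComp (φ ψ : 𝓓(Ω, ℝ)) (L : ℝ → ℝ) (hL : ContDiff ℝ ∞ L)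
    (x v : EuclideanSpace ℝ (Fin N)) :
    inner ℝ v (gradient (sqMulComp φ ψ L hL) x) =
      2 * φ x * L (ψ x) * inner ℝ v (gradient φ x) +
        φ x ^ 2 * deriv L (ψ x) * inner ℝ v (gradient ψ x) := by
  have hφ := (differentiable_testFunction φ x).hasFDerivAt
  have hψ := (differentiable_testFunction ψ x).hasFDerivAt
  have hL' : HasDerivAt L (deriv L (ψ x)) (ψ x) :=
    ((hL.differentiable (by simp)) (ψ x)).hasDerivAt
  have h := (hφ.pow 2).mul (hL'.comp_hasFDerivAt x hψ)
  have h' : HasFDerivAt (sqMulComp φ ψ L hL) _ x := h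
  rw [real_inner_comm, inner_gradient_left, h'.fderiv, real_inner_comm (gradient φ x) v,
    real_inner_comm (gradient ψ x) v, inner_gradient_left, inner_gradient_left]
  simp
  ring

/-- Poincaré's inequality in the form `∫ φ² ≤ 2D ∫ |φ| |∇φ|`, where `D` bounds `Ω`; it is obtained
by integrating `∂₁(x₁ φ²)`. -/
theorem integral_sq_le_integral_mul_gradient (hN : 0 < N) (φ : 𝓓(Ω, ℝ)) {D : ℝ}
    (hD : ∀ x ∈ (Ω : Set (EuclideanSpace ℝ (Fin N))), ‖x‖ ≤ D) :
    ∫ x in Ω, φ x ^ 2 ≤ 2 * D * ∫ x in Ω, |φ x| * ‖gradient φ x‖ := by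
  set i : Fin N := ⟨0, hN⟩
  set e : EuclideanSpace ℝ (Fin N) := EuclideanSpace.single i 1
  set l : EuclideanSpace ℝ (Fin N) →L[ℝ] ℝ := EuclideanSpace.proj i
  have hle : l e = 1 := by simp [l, e, i]
  have hd := differentiable_testFunction φ
  have hc : Continuous fun x => fderiv ℝ φ x e := by
    have h : ContDiff ℝ ∞ φ := φ.contDiff
    exact (h.continuous_fderiv (by simp)).clm_apply continuous_const
  have hf2 : ∀ x, HasFDerivAt (fun x => φ x ^ 2) ((2 * φ x) • fderiv ℝ φ x) x := fun x => by
    simpa using (hd x).hasFDerivAt.pow 2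
  have hcs : ∀ g : EuclideanSpace ℝ (Fin N) → ℝ, Continuous g → (∀ x, φ x = 0 → g x = 0) →
      Integrable g := fun g hg h0 =>
    hg.integrable_of_hasCompactSupport (φ.hasCompactSupport.mono fun x hx => by
      simp only [Function.mem_support] at hx ⊢
      exact fun h => hx (h0 x h))
  have key := integral_mul_fderiv_eq_neg_fderiv_mul_of_integrable (μ := volume)
    (f := fun x => l x) (g := fun x => φ x ^ 2) (v := e)
    (by
      refine hcs _ ?_ fun x hx => by simp [hx]
      simp only [ContinuousLinearMap.fderiv]; fun_prop)
    (by
      refine hcs _ ?_ fun x hx => by simp [(hf2 x).fderiv, hx]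
      simp only [fun x => (hf2 x).fderiv, smul_apply, smul_eq_mul]
      fun_prop)
    (hcs _ (by fun_prop) fun x hx => by simp [hx])
    (fun x _ => l.differentiableAt) (fun x _ => (hf2 x).differentiableAt)
  simp only [fun x => (hf2 x).fderiv, smul_apply, smul_eq_mul,
    ContinuousLinearMap.fderiv, hle, one_mul] at key
  have h0 : ∀ x ∉ (Ω : Set (EuclideanSpace ℝ (Fin N))), φ x = 0 := fun x hx =>
    image_eq_zero_of_notMem_tsupport fun h => hx (φ.tsupport_subset h)
  have e1 : ∫ x in Ω, φ x ^ 2 = ∫ x, φ x ^ 2 :=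
    setIntegral_eq_integral_of_forall_compl_eq_zero fun x hx => by simp [h0 x hx]
  have e2 : ∫ x in Ω, l x * (2 * φ x * fderiv ℝ φ x e) = ∫ x, l x * (2 * φ x * fderiv ℝ φ x e) :=
    setIntegral_eq_integral_of_forall_compl_eq_zero fun x hx => by simp [h0 x hx]
  rw [← e1, ← e2] at key
  rw [← neg_eq_iff_eq_neg.mpr key, ← integral_neg, ← integral_const_mul]
  have hcg := continuous_gradient_testFunction φ
  have hes : ‖e‖ = 1 := by simp [e]
  have hl : ∀ x, |l x| ≤ ‖x‖ := fun x => by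
    simpa [l] using EuclideanSpace.norm_eq x ▸ PiLp.norm_apply_le x i
  have hfe : ∀ x, |fderiv ℝ φ x e| ≤ ‖gradient φ x‖ := fun x => by
    rw [← inner_gradient_left]
    simpa [hes] using abs_real_inner_le_norm (gradient φ x) e
  refine setIntegral_mono_on ?_ ?_ Ω.isOpen.measurableSet fun x hx => ?_
  · exact (hcs _ (by fun_prop) fun x hx => by simp [hx]).integrableOn.neg
  · exact (hcs _ (by fun_prop) fun x hx => by simp [hx]).integrableOn
  · calc -(l x * (2 * φ x * fderiv ℝ φ x e)) ≤ |l x * (2 * φ x * fderiv ℝ φ x e)| := neg_le_abs _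
      _ = 2 * |l x| * (|φ x| * |fderiv ℝ φ x e|) := by simp only [abs_mul, abs_two]; ring
      _ ≤ 2 * D * (|φ x| * ‖gradient φ x‖) := by
        have := (hl x).trans (hD x hx)
        have := (abs_nonneg _).trans this
        gcongr
        exact hfe x

end TestFunctions

/-! ### Sobolev embedding and nonlinear test functions -/

section Approximation

variable {N : ℕ} {Ω : Opens (EuclideanSpace ℝ (Fin N))}
  {u : EuclideanSpace ℝ (Fin N) → ℝ} {w : EuclideanSpace ℝ (Fin N) → EuclideanSpace ℝ (Fin N)}

theorem MemH10.exists_seq (hu : MemH10 Ω u w) :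
    ∃ ψ : ℕ → 𝓓(Ω, ℝ),
      Tendsto (fun k => eLpNorm (fun x => u x - ψ k x) 2 (volume.restrict Ω)) atTop (𝓝 0) ∧
      Tendsto (fun k => eLpNorm (fun x => w x - gradient (ψ k) x) 2 (volume.restrict Ω))
        atTop (𝓝 0) ∧
      ∀ᵐ x ∂(volume.restrict (Ω : Set (EuclideanSpace ℝ (Fin N)))),
        Tendsto (fun k => ψ k x) atTop (𝓝 (u x)) := by
  have hpos : ∀ k : ℕ, (0 : ℝ≥0∞) < ((k : ℝ≥0∞) + 1)⁻¹ := fun k => by simp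
  choose ψ hψ1 hψ2 using fun k : ℕ => hu.approx _ (hpos k)
  have h0 : Tendsto (fun k : ℕ => ((k : ℝ≥0∞) + 1)⁻¹) atTop (𝓝 0) := by
    have := (tendsto_add_atTop_iff_nat 1).mpr ENNReal.tendsto_inv_nat_nhds_zero
    simpa using this
  have h1 := tendsto_of_tendsto_of_tendsto_of_le_of_le tendsto_const_nhds h0
    (fun _ => zero_le) hψ1
  have h2 := tendsto_of_tendsto_of_tendsto_of_le_of_le tendsto_const_nhds h0
    (fun _ => zero_le) hψ2
  have hm : TendstoInMeasure (volume.restrict (Ω : Set (EuclideanSpace ℝ (Fin N))))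
      (fun k => (ψ k : EuclideanSpace ℝ (Fin N) → ℝ)) atTop u := by
    refine tendstoInMeasure_of_tendsto_eLpNorm (p := 2) (by simp)
      (fun k => (ψ k).continuous.aestronglyMeasurable) hu.memLp.1 ?_
    refine h1.congr fun k => ?_
    rw [← eLpNorm_neg]
    congr 1
    ext x
    simp
  obtain ⟨ns, hns, hae⟩ := hm.exists_seq_tendsto_ae
  exact ⟨fun k => ψ (ns k), h1.comp hns.tendsto_atTop, h2.comp hns.tendsto_atTop, hae⟩

/-- The Sobolev embedding `H¹₀(Ω) ⊆ L^{2*}(Ω)`. -/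
theorem MemH10.memLp_criticalExponent (hN : 3 ≤ N) (hu : MemH10 Ω u w) :
    MemLp u (ENNReal.ofReal (criticalExponent N)) (volume.restrict Ω) := by
  obtain ⟨ψ, -, hg, hae⟩ := hu.exists_seq
  have hN' : (3 : ℝ) ≤ N := by exact_mod_cast hN
  set q : NNReal := (criticalExponent N).toNNReal
  have hq : (q : ℝ) = criticalExponent N := by
    refine Real.coe_toNNReal _ ?_
    rw [criticalExponent]
    exact div_nonneg (by positivity) (by linarith)
  change MemLp u (q : ℝ≥0∞) _
  refine ⟨hu.memLp.1, ?_⟩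
  have hGNS : ∀ k, eLpNorm (ψ k) q (volume.restrict Ω) ≤
      eLpNormLESNormFDerivOfEqInnerConst (volume : Measure (EuclideanSpace ℝ (Fin N))) 2 *
        eLpNorm (gradient (ψ k)) 2 (volume.restrict Ω) := fun k => by
    have hc : ContDiff ℝ ∞ (ψ k) := (ψ k).contDiff
    have h := eLpNorm_le_eLpNorm_fderiv_of_eq_inner
      (volume : Measure (EuclideanSpace ℝ (Fin N))) (hc.of_le (by norm_cast))
      (ψ k).hasCompactSupport (p := 2) (p' := q) (by norm_num)
      (by rw [finrank_euclideanSpace_fin]; omega) (by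
        rw [hq, criticalExponent, finrank_euclideanSpace_fin]
        have : (N : ℝ) - 2 ≠ 0 := by linarith
        push_cast
        field_simp)
    refine (eLpNorm_restrict_le _ _ _ _).trans (h.trans (mul_le_mul' (le_of_eq (by simp)) ?_))
    have hs : Function.support (gradient (ψ k)) ⊆ Ω := fun x hx => by
      refine (ψ k).tsupport_subset (tsupport_fderiv_subset ℝ (subset_closure ?_))
      simp only [Function.mem_support] at hx ⊢
      contrapose! hx
      simp [gradient, hx]
    rw [eLpNorm_restrict_eq_of_support_subset hs]
    refine le_of_eq (eLpNorm_congr_norm_ae (Eventually.of_forall fun x => ?_))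
    simp [gradient]
  have hlim := Lp.eLpNorm_lim_le_liminf_eLpNorm (p := q)
    (fun k => (ψ k).continuous.aestronglyMeasurable) u hae
  refine hlim.trans_lt ?_
  refine (liminf_le_liminf (Eventually.of_forall hGNS)).trans_lt ?_
  have hb : ∀ᶠ k in atTop, eLpNorm (gradient (ψ k)) 2 (volume.restrict Ω) ≤
      eLpNorm w 2 (volume.restrict Ω) + 1 := by
    filter_upwards [hg.eventually_le_const (u := 1) (by simp)] with k hk
    have := eLpNorm_sub_le (p := 2) hu.memLp_grad.1
      (hu.memLp_grad.1.sub (memLp_gradient_testFunction (ψ k) 2).1) (by norm_num)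
    rw [sub_sub_cancel] at this
    exact this.trans (by gcongr; exact hk)
  refine lt_of_le_of_lt (b := (eLpNormLESNormFDerivOfEqInnerConst
    (volume : Measure (EuclideanSpace ℝ (Fin N))) 2 : ℝ≥0∞) *
      (eLpNorm w 2 (volume.restrict Ω) + 1)) ?_ ?_
  · refine liminf_le_of_frequently_le (Eventually.frequently ?_)
    filter_upwards [hb] with k hk
    gcongr
  · exact ENNReal.mul_lt_top (by simp) (ENNReal.add_lt_top.mpr ⟨hu.memLp_grad.2, by simp⟩)

/-- The equation with right-hand side `f`, tested with `φ² L(u)`. This is admissible because `u` is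
the limit of test functions `ψₖ`, and `φ² L(ψₖ)` is a test function. -/
theorem MemH10.integral_test_sq_mul_comp (hu : MemH10 Ω u w) {f : EuclideanSpace ℝ (Fin N) → ℝ}
    (hf : Integrable f (volume.restrict Ω))
    (hsol : ∀ φ : 𝓓(Ω, ℝ), ∫ x in Ω, inner ℝ (w x) (gradient φ x) = ∫ x in Ω, f x * φ x)
    {L : ℝ → ℝ} (hL : ContDiff ℝ ∞ L) {C : ℝ} (hC : ∀ s, |L s| ≤ C ∧ |deriv L s| ≤ C)
    (φ : 𝓓(Ω, ℝ)) :
    Integrable (fun x => 2 * φ x * L (u x) * inner ℝ (w x) (gradient φ x) +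
      φ x ^ 2 * deriv L (u x) * ‖w x‖ ^ 2) (volume.restrict Ω) ∧
    ∫ x in Ω, (2 * φ x * L (u x) * inner ℝ (w x) (gradient φ x) +
        φ x ^ 2 * deriv L (u x) * ‖w x‖ ^ 2) =
      ∫ x in Ω, f x * L (u x) * φ x ^ 2 := by
  obtain ⟨ψ, -, hg, hae⟩ := hu.exists_seq
  obtain ⟨B, hB0, hB⟩ := exists_bound_testFunction φ
  have hC0 : 0 ≤ C := (abs_nonneg _).trans (hC 0).1
  have hLc : Continuous L := hL.continuous
  have hL'c : Continuous (deriv L) := hL.continuous_deriv (by simp)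
  have hφc := φ.continuous
  have hgφ := continuous_gradient_testFunction φ
  have hwm := hu.memLp_grad.1
  have hw2 : Integrable (fun x => ‖w x‖ ^ 2) (volume.restrict Ω) := hu.memLp_grad.norm.integrable_sq
  have hw1 : Integrable (fun x => ‖w x‖ * ‖gradient φ x‖) (volume.restrict Ω) :=
    hu.memLp_grad.norm.integrable_mul (memLp_gradient_testFunction φ 2).norm
  -- the integrand with the gradient of `ψₖ` replaced by `w`
  set F : (EuclideanSpace ℝ (Fin N) → ℝ) → EuclideanSpace ℝ (Fin N) → ℝ := fun v x =>
    2 * φ x * L (v x) * inner ℝ (w x) (gradient φ x) + φ x ^ 2 * deriv L (v x) * ‖w x‖ ^ 2 with hF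
  have hFm : ∀ v : EuclideanSpace ℝ (Fin N) → ℝ,
      AEStronglyMeasurable v (volume.restrict Ω) →
      AEStronglyMeasurable (F v) (volume.restrict Ω) := fun v hv => by
    have h1 := hLc.comp_aestronglyMeasurable hv
    have h2 := hL'c.comp_aestronglyMeasurable hv
    have h3 : AEStronglyMeasurable φ (volume.restrict Ω) := hφc.aestronglyMeasurable
    have h4 : AEStronglyMeasurable (gradient φ) (volume.restrict Ω) := hgφ.aestronglyMeasurable
    exact (((h3.const_mul 2).mul h1).mul (hwm.inner h4)).add
      (((h3.pow 2).mul h2).mul (hwm.norm.pow 2))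
  have hFb : ∀ v x, ‖F v x‖ ≤
      2 * B * C * (‖w x‖ * ‖gradient φ x‖) + B ^ 2 * C * ‖w x‖ ^ 2 := fun v x => by
    have h1 := abs_real_inner_le_norm (w x) (gradient φ x)
    rw [Real.norm_eq_abs]
    refine (abs_add_le _ _).trans ?_
    simp only [abs_mul, abs_pow, abs_two, abs_norm]
    gcongr
    · exact (hB x).1
    · exact (hC _).1
    · exact (hB x).1
    · exact (hC _).2
  have hbi : Integrable (fun x => 2 * B * C * (‖w x‖ * ‖gradient φ x‖) + B ^ 2 * C * ‖w x‖ ^ 2)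
      (volume.restrict Ω) := (hw1.const_mul _).add (hw2.const_mul _)
  have hψm : ∀ k, AEStronglyMeasurable (ψ k) (volume.restrict Ω) := fun k =>
    (ψ k).continuous.aestronglyMeasurable
  refine ⟨hbi.mono' (hFm u hu.memLp.1) (Eventually.of_forall (hFb u)), ?_⟩
  have hlimF : Tendsto (fun k => ∫ x in Ω, F (ψ k) x) atTop (𝓝 (∫ x in Ω, F u x)) := by
    refine tendsto_integral_of_dominated_convergence _ (fun k => hFm _ (hψm k)) hbi
      (fun k => Eventually.of_forall (hFb _)) ?_
    filter_upwards [hae] with x hx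
    exact (((hLc.tendsto _).comp hx).const_mul (2 * φ x) |>.mul_const _).add
      ((((hL'c.tendsto _).comp hx).const_mul (φ x ^ 2)).mul_const _)
  have hlimR : Tendsto (fun k => ∫ x in Ω, f x * L (ψ k x) * φ x ^ 2) atTop
      (𝓝 (∫ x in Ω, f x * L (u x) * φ x ^ 2)) := by
    refine tendsto_integral_of_dominated_convergence (fun x => |f x| * C * B ^ 2) (fun k => ?_)
      ((hf.abs.mul_const C).mul_const _) (fun k => Eventually.of_forall fun x => ?_) ?_
    · exact (hf.1.mul (hLc.comp_aestronglyMeasurable (hψm k))).mul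
        (hφc.pow 2).aestronglyMeasurable
    · rw [Real.norm_eq_abs]
      simp only [abs_mul, abs_pow]
      gcongr
      · exact (hC _).1
      · exact (hB x).1
    · filter_upwards [hae] with x hx
      exact ((((hLc.tendsto _).comp hx).const_mul (f x)).mul_const _)
  -- the error term, controlled by `‖w - ∇ψₖ‖` in `L²`
  set H : ℕ → EuclideanSpace ℝ (Fin N) → ℝ := fun k x =>
    φ x ^ 2 * deriv L (ψ k x) * inner ℝ (w x) (w x - gradient (ψ k) x) with hH
  have hdm : ∀ k, MemLp (fun x => w x - gradient (ψ k) x) 2 (volume.restrict Ω) := fun k =>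
    hu.memLp_grad.sub (memLp_gradient_testFunction (ψ k) 2)
  have hHm : ∀ k, AEStronglyMeasurable (H k) (volume.restrict Ω) := fun k =>
    ((hφc.pow 2).aestronglyMeasurable.mul (hL'c.comp_aestronglyMeasurable (hψm k))).mul
      (hwm.inner (hdm k).1)
  have hHb : ∀ k, eLpNorm (H k) 1 (volume.restrict Ω) ≤
      ENNReal.ofReal (B ^ 2 * C) * (eLpNorm w 2 (volume.restrict Ω) *
        eLpNorm (fun x => w x - gradient (ψ k) x) 2 (volume.restrict Ω)) := fun k => by
    have h1 : eLpNorm (fun x => inner ℝ (w x) (w x - gradient (ψ k) x)) 1 (volume.restrict Ω) ≤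
        (1 : NNReal) * eLpNorm w 2 (volume.restrict Ω) *
          eLpNorm (fun x => w x - gradient (ψ k) x) 2 (volume.restrict Ω) :=
      eLpNorm_le_eLpNorm_mul_eLpNorm'_of_norm hwm (hdm k).1 (fun a b => inner ℝ a b) 1
      (Eventually.of_forall fun x => by
        simpa using abs_real_inner_le_norm (w x) (w x - gradient (ψ k) x))
    refine (eLpNorm_le_mul_eLpNorm_of_ae_le_mul (c := B ^ 2 * C)
      (g := fun x => inner ℝ (w x) (w x - gradient (ψ k) x))
      (Eventually.of_forall fun x => ?_) 1).trans ?_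
    · simp only [hH, Real.norm_eq_abs, abs_mul, abs_pow]
      gcongr
      · exact (hB x).1
      · exact (hC _).2
    · gcongr
      simpa using h1
  have hHi : ∀ k, Integrable (H k) (volume.restrict Ω) := fun k => by
    refine memLp_one_iff_integrable.mp ⟨hHm k, (hHb k).trans_lt ?_⟩
    exact ENNReal.mul_lt_top (by simp) (ENNReal.mul_lt_top hu.memLp_grad.2 (hdm k).2)
  have hlimH : Tendsto (fun k => ∫ x in Ω, H k x) atTop (𝓝 0) := by
    have h0 := tendsto_integral_of_L1' (fun _ => (0 : ℝ)) aestronglyMeasurable_zero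
      (F := H) (l := atTop) (μ := volume.restrict Ω) (Eventually.of_forall hHi) ?_
    · simpa using h0
    · have h1 : Tendsto (fun k => ENNReal.ofReal (B ^ 2 * C) * (eLpNorm w 2 (volume.restrict Ω) *
        eLpNorm (fun x => w x - gradient (ψ k) x) 2 (volume.restrict Ω))) atTop (𝓝 0) := by
        have := ENNReal.Tendsto.const_mul (a := ENNReal.ofReal (B ^ 2 * C))
          (ENNReal.Tendsto.const_mul (a := eLpNorm w 2 (volume.restrict Ω)) hg
          (Or.inr hu.memLp_grad.2.ne)) (Or.inr (by simp))
        simpa using this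
      refine tendsto_of_tendsto_of_tendsto_of_le_of_le tendsto_const_nhds h1
        (fun _ => zero_le) fun k => ?_
      refine le_trans (le_of_eq ?_) (hHb k)
      congr 1
      ext x
      simp
  have heq : ∀ k, ∫ x in Ω, F (ψ k) x - H k x = ∫ x in Ω, f x * L (ψ k x) * φ x ^ 2 := fun k => by
    have h1 := hsol (sqMulComp φ (ψ k) L hL)
    simp only [inner_gradient_sqMulComp, sqMulComp_apply] at h1
    calc _ = _ := integral_congr_ae (Eventually.of_forall fun x => ?_)
      _ = _ := h1
      _ = _ := integral_congr_ae (Eventually.of_forall fun x => by ring)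
    simp only [hF, hH, inner_sub_right, real_inner_self_eq_norm_sq]
    ring
  have hlim : Tendsto (fun k => ∫ x in Ω, F (ψ k) x - H k x) atTop (𝓝 (∫ x in Ω, F u x)) := by
    have := hlimF.sub hlimH
    rw [sub_zero] at this
    refine this.congr fun k => (integral_sub ?_ (hHi k)).symm
    exact hbi.mono' (hFm _ (hψm k)) (Eventually.of_forall (hFb _))
  exact tendsto_nhds_unique hlim (by simpa only [heq] using hlimR)

end Approximation

/-! ### Two families of smooth functions on the real line -/

section AuxiliaryFunctions

/-- A smooth, positive function on the whole of `ℝ` that tends to `s` as `ε → 0`, for `s > 0`, and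
has derivative at least `1` on `(0, ∞)`. The arctangent compensates the deficit in the derivative of
`√(ε² + s²)`, and the constant `2ε` keeps the sum away from `0` for `s ≤ 0`. -/
noncomputable def regId (ε s : ℝ) : ℝ :=
  2 * ε + √(ε ^ 2 + s ^ 2) + ε * Real.arctan (s / ε)

theorem le_regId {ε : ℝ} (hε : 0 < ε) (s : ℝ) : ε / 4 ≤ regId ε s := by
  have h1 := Real.neg_pi_div_two_lt_arctan (s / ε)
  have h2 := Real.pi_lt_d2
  have h3 := Real.sqrt_nonneg (ε ^ 2 + s ^ 2)
  have h4 : -(7 / 4) ≤ Real.arctan (s / ε) := by linarith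
  have := mul_le_mul_of_nonneg_left h4 hε.le
  rw [regId]
  linarith

theorem hasDerivAt_regId {ε : ℝ} (hε : 0 < ε) (s : ℝ) :
    HasDerivAt (regId ε) (s / √(ε ^ 2 + s ^ 2) + ε ^ 2 / (ε ^ 2 + s ^ 2)) s := by
  have hp : 0 < ε ^ 2 + s ^ 2 := by positivity
  have h1 : HasDerivAt (fun s => √(ε ^ 2 + s ^ 2)) ((2 * s) / (2 * √(ε ^ 2 + s ^ 2))) s := by
    refine HasDerivAt.sqrt ?_ hp.ne'
    simpa using (hasDerivAt_pow 2 s).const_add (ε ^ 2)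
  have h2 := (((hasDerivAt_id s).div_const ε).arctan).const_mul ε
  have h3 := (h1.const_add (2 * ε)).add h2
  refine h3.congr_deriv ?_
  have : 0 < √(ε ^ 2 + s ^ 2) := Real.sqrt_pos.mpr hp
  simp only [id]
  field_simp

theorem abs_deriv_regId_le {ε : ℝ} (hε : 0 < ε) (s : ℝ) :
    |s / √(ε ^ 2 + s ^ 2) + ε ^ 2 / (ε ^ 2 + s ^ 2)| ≤ 2 := by
  have hp : 0 < ε ^ 2 + s ^ 2 := by positivity
  have h1 : |s / √(ε ^ 2 + s ^ 2)| ≤ 1 := by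
    rw [abs_div, abs_of_nonneg (Real.sqrt_nonneg _), div_le_one (Real.sqrt_pos.mpr hp)]
    exact Real.abs_le_sqrt (by nlinarith [sq_nonneg ε])
  have h2 : |ε ^ 2 / (ε ^ 2 + s ^ 2)| ≤ 1 := by
    rw [abs_of_nonneg (by positivity), div_le_one hp]
    nlinarith [sq_nonneg s]
  exact (abs_add_le _ _).trans (by linarith)

theorem one_le_deriv_regId {ε s : ℝ} (hε : 0 < ε) (hs : 0 < s) :
    1 ≤ s / √(ε ^ 2 + s ^ 2) + ε ^ 2 / (ε ^ 2 + s ^ 2) := by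
  have hp : 0 < ε ^ 2 + s ^ 2 := by positivity
  obtain ⟨q, hq⟩ : ∃ q, q = √(ε ^ 2 + s ^ 2) := ⟨_, rfl⟩
  have hq0 : 0 < q := hq ▸ Real.sqrt_pos.mpr hp
  have hq2 : q ^ 2 = ε ^ 2 + s ^ 2 := hq ▸ Real.sq_sqrt hp.le
  have hsq : s ≤ q := by nlinarith [sq_nonneg ε]
  rw [← hq, ← hq2, show ε ^ 2 = q ^ 2 - s ^ 2 by linarith]
  rw [div_add_div _ _ hq0.ne' (by positivity), le_div_iff₀ (by positivity)]
  nlinarith [mul_nonneg hs.le (mul_nonneg hq0.le (sub_nonneg.mpr hsq))]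

theorem self_le_regId {ε s : ℝ} (hε : 0 < ε) (hs : 0 < s) : s ≤ regId ε s := by
  have h1 : s ≤ √(ε ^ 2 + s ^ 2) := Real.le_sqrt_of_sq_le (by nlinarith [sq_nonneg ε])
  have h2 : 0 ≤ Real.arctan (s / ε) := Real.arctan_nonneg.mpr (by positivity)
  have := mul_nonneg hε.le h2
  rw [regId]
  linarith

theorem tendsto_regId {ε : ℕ → ℝ} (hε : Tendsto ε atTop (𝓝 0)) {s : ℝ} (hs : 0 < s) :
    Tendsto (fun n => regId (ε n) s) atTop (𝓝 s) := by
  have h1 : Tendsto (fun n => √(ε n ^ 2 + s ^ 2)) atTop (𝓝 s) := by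
    have := ((hε.pow 2).add_const (s ^ 2)).sqrt
    simpa [Real.sqrt_sq hs.le] using this
  have h2 : Tendsto (fun n => ε n * Real.arctan (s / ε n)) atTop (𝓝 0) := by
    refine squeeze_zero_norm (a := fun n => |ε n| * 2) (fun n => ?_) ?_
    · rw [norm_mul, Real.norm_eq_abs, Real.norm_eq_abs]
      gcongr
      rw [abs_le]
      have := Real.neg_pi_div_two_lt_arctan (s / ε n)
      have := Real.arctan_lt_pi_div_two (s / ε n)
      have := Real.pi_lt_d2
      constructor <;> linarith
    · simpa using hε.abs.mul_const 2
  have := ((hε.const_mul 2).add h1).add h2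
  simpa [regId] using this

theorem contDiff_regId {ε : ℝ} (hε : 0 < ε) : ContDiff ℝ ∞ (regId ε) := by
  have h1 : ContDiff ℝ ∞ fun s : ℝ => √(ε ^ 2 + s ^ 2) :=
    ContDiff.sqrt (by fun_prop) fun s => by positivity
  have h2 : ContDiff ℝ ∞ fun s : ℝ => Real.arctan (s / ε) :=
    Real.contDiff_arctan.comp (by fun_prop)
  exact (contDiff_const.add h1).add (contDiff_const.mul h2)

/-- A smooth bounded function `L` for which `K(s) = s² L(s)` is increasing on `(0, ∞)`, with slope
bounded below near `s₀`, while `K(s) / s` is of size `δ`: up to the harmless factor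
`s² / (1 + s²)`, `K` is a step of height `πδ` and width `δ` at `s₀`. -/
noncomputable def stepFun (s₀ δ s : ℝ) : ℝ :=
  δ * (Real.arctan ((s - s₀) / δ) + Real.pi / 2) / (1 + s ^ 2)

variable {s₀ δ : ℝ}

theorem contDiff_stepFun : ContDiff ℝ ∞ (stepFun s₀ δ) := by
  have h1 : ContDiff ℝ ∞ fun s : ℝ => Real.arctan ((s - s₀) / δ) :=
    Real.contDiff_arctan.comp (by fun_prop)
  exact (contDiff_const.mul (h1.add contDiff_const)).div (by fun_prop) fun s => by positivity

theorem arctan_add_pi_div_two_mem (hδ : 0 < δ) (x : ℝ) :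
    0 ≤ δ * (Real.arctan x + Real.pi / 2) ∧ δ * (Real.arctan x + Real.pi / 2) ≤ 4 * δ := by
  have h1 := Real.neg_pi_div_two_lt_arctan x
  have h2 := Real.arctan_lt_pi_div_two x
  have h3 := Real.pi_lt_d2
  exact ⟨mul_nonneg hδ.le (by linarith), by nlinarith⟩

theorem deriv_stepFun (hδ : 0 < δ) (s : ℝ) :
    deriv (stepFun s₀ δ) s = (1 + ((s - s₀) / δ) ^ 2)⁻¹ / (1 + s ^ 2) -
      δ * (Real.arctan ((s - s₀) / δ) + Real.pi / 2) * (2 * s) / (1 + s ^ 2) ^ 2 := by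
  have h1 := ((((((hasDerivAt_id s).sub_const s₀).div_const δ).arctan).add_const
    (Real.pi / 2)).const_mul δ)
  have h2 : HasDerivAt (fun s : ℝ => 1 + s ^ 2) (2 * s) s := by
    simpa using (hasDerivAt_pow 2 s).const_add 1
  refine (h1.div h2 (by positivity)).deriv.trans ?_
  simp only [id]
  have : (1 + ((s - s₀) / δ) ^ 2) ≠ 0 := by positivity
  field_simp

theorem abs_stepFun_le (hδ : 0 < δ) (s : ℝ) : |stepFun s₀ δ s| ≤ 1 + 8 * δ := by
  obtain ⟨h1, h2⟩ := arctan_add_pi_div_two_mem hδ ((s - s₀) / δ)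
  rw [stepFun, abs_of_nonneg (by positivity), div_le_iff₀ (by positivity)]
  nlinarith [sq_nonneg s, mul_nonneg hδ.le (sq_nonneg s)]

theorem abs_deriv_stepFun_le (hδ : 0 < δ) (s : ℝ) : |deriv (stepFun s₀ δ) s| ≤ 1 + 8 * δ := by
  obtain ⟨h1, h2⟩ := arctan_add_pi_div_two_mem hδ ((s - s₀) / δ)
  rw [deriv_stepFun hδ]
  refine (abs_sub _ _).trans (add_le_add ?_ ?_)
  · rw [abs_of_nonneg (by positivity), div_le_one (by positivity)]
    have : (1 + ((s - s₀) / δ) ^ 2)⁻¹ ≤ 1 :=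
      inv_le_one_of_one_le₀ (by nlinarith [sq_nonneg ((s - s₀) / δ)])
    nlinarith [sq_nonneg s]
  · rw [abs_div, abs_mul _ (2 * s), abs_of_nonneg h1, abs_mul 2 s, abs_two,
      abs_of_nonneg (a := (1 + s ^ 2) ^ 2) (by positivity), div_le_iff₀ (by positivity)]
    have h3 : |s| ≤ (1 + s ^ 2) ^ 2 := by
      rw [abs_le]; constructor <;> nlinarith [sq_nonneg (s - 1), sq_nonneg (s + 1), sq_nonneg (s^2)]
    have := mul_le_mul h2 h3 (abs_nonneg s) (by positivity)
    linarith

theorem stepFun_nonneg (hδ : 0 < δ) (s : ℝ) : 0 ≤ stepFun s₀ δ s :=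
  div_nonneg (arctan_add_pi_div_two_mem hδ _).1 (by positivity)

theorem self_mul_stepFun_le (hδ : 0 < δ) {s : ℝ} (hs : 0 < s) : s * stepFun s₀ δ s ≤ 2 * δ := by
  obtain ⟨h1, h2⟩ := arctan_add_pi_div_two_mem hδ ((s - s₀) / δ)
  rw [stepFun, ← mul_div_assoc, div_le_iff₀ (by positivity)]
  nlinarith [mul_le_mul_of_nonneg_left h2 hs.le, mul_nonneg hδ.le (sq_nonneg (s - 1))]

theorem abs_sq_mul_deriv_stepFun_le (hδ : 0 < δ) (hδ1 : δ ≤ 1) {s : ℝ} (hs : 0 < s) :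
    |s ^ 2 * deriv (stepFun s₀ δ) s| ≤ 9 := by
  obtain ⟨h1, h2⟩ := arctan_add_pi_div_two_mem hδ ((s - s₀) / δ)
  obtain ⟨A, hA⟩ : ∃ A, A = δ * (Real.arctan ((s - s₀) / δ) + Real.pi / 2) := ⟨_, rfl⟩
  rw [deriv_stepFun hδ, ← hA, mul_sub]
  rw [← hA] at h1 h2
  refine (abs_sub _ _).trans ?_
  have ha : |s ^ 2 * ((1 + ((s - s₀) / δ) ^ 2)⁻¹ / (1 + s ^ 2))| ≤ 1 := by
    have : (1 + ((s - s₀) / δ) ^ 2)⁻¹ ≤ 1 :=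
      inv_le_one_of_one_le₀ (by nlinarith [sq_nonneg ((s - s₀) / δ)])
    rw [abs_of_nonneg (by positivity), ← mul_div_assoc, div_le_one (by positivity)]
    nlinarith [sq_nonneg s]
  have hb : |s ^ 2 * (A * (2 * s) / (1 + s ^ 2) ^ 2)| ≤ 8 := by
    rw [abs_of_nonneg (by positivity), ← mul_div_assoc, div_le_iff₀ (by positivity)]
    have h3 : s ^ 3 ≤ (1 + s ^ 2) ^ 2 := by
      nlinarith [sq_nonneg (s ^ 2 - s), sq_nonneg s]
    have h4 : A * s ^ 3 ≤ 4 * (1 + s ^ 2) ^ 2 :=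
      mul_le_mul (by linarith) h3 (by positivity) (by norm_num)
    linarith
  linarith

theorem two_mul_self_mul_stepFun_add (hδ : 0 < δ) {s : ℝ} (hs : 0 < s) :
    s ^ 2 / (1 + s ^ 2) * (1 + ((s - s₀) / δ) ^ 2)⁻¹ ≤
      2 * (s * stepFun s₀ δ s) + s ^ 2 * deriv (stepFun s₀ δ) s := by
  obtain ⟨h1, h2⟩ := arctan_add_pi_div_two_mem hδ ((s - s₀) / δ)
  rw [deriv_stepFun hδ, stepFun]
  set A := δ * (Real.arctan ((s - s₀) / δ) + Real.pi / 2)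
  have h : 2 * (s * (A / (1 + s ^ 2))) + s ^ 2 * ((1 + ((s - s₀) / δ) ^ 2)⁻¹ / (1 + s ^ 2) -
      A * (2 * s) / (1 + s ^ 2) ^ 2) = s ^ 2 / (1 + s ^ 2) * (1 + ((s - s₀) / δ) ^ 2)⁻¹ +
        2 * s * A / (1 + s ^ 2) ^ 2 := by
    have : (1 + ((s - s₀) / δ) ^ 2) ≠ 0 := by positivity
    have : 1 + s ^ 2 ≠ 0 := by positivity
    generalize (1 + ((s - s₀) / δ) ^ 2)⁻¹ = B
    field_simp
    ring
  rw [h]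
  have : 0 ≤ 2 * s * A / (1 + s ^ 2) ^ 2 := by positivity
  linarith

end AuxiliaryFunctions

/-! ### Picone inequality and the spectral gap -/

section SpectralGap

variable {N : ℕ} {Ω : Opens (EuclideanSpace ℝ (Fin N))}
  {u V : EuclideanSpace ℝ (Fin N) → ℝ} {w : EuclideanSpace ℝ (Fin N) → EuclideanSpace ℝ (Fin N)}

/-- Picone's identity for a positive solution `u` of `-Δu = V u`, as an inequality with its
remainder `u² |∇(φ/u)|² = |∇φ - (φ/u) ∇u|²`. It is the limit `ε → 0` of the equation tested with
`φ² / regId ε u`. -/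
theorem MemH10.picone (hu : MemH10 Ω u w)
    (hpos : ∀ᵐ x ∂(volume.restrict (Ω : Set (EuclideanSpace ℝ (Fin N)))), 0 < u x)
    (hVm : AEStronglyMeasurable V (volume.restrict Ω))
    (hV : ∀ᵐ x ∂(volume.restrict (Ω : Set (EuclideanSpace ℝ (Fin N)))), 0 ≤ V x)
    (hVu : Integrable (fun x => V x * u x) (volume.restrict Ω))
    (hsol : ∀ φ : 𝓓(Ω, ℝ), ∫ x in Ω, inner ℝ (w x) (gradient φ x) = ∫ x in Ω, V x * u x * φ x)
    (φ : 𝓓(Ω, ℝ)) :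
    Integrable (fun x => V x * φ x ^ 2) (volume.restrict Ω) ∧
    Integrable (fun x => ‖gradient φ x - (φ x / u x) • w x‖ ^ 2) (volume.restrict Ω) ∧
    (∫ x in Ω, V x * φ x ^ 2) + ∫ x in Ω, ‖gradient φ x - (φ x / u x) • w x‖ ^ 2 ≤
      ∫ x in Ω, ‖gradient φ x‖ ^ 2 := by
  have hum := hu.memLp.1
  have hwm := hu.memLp_grad.1
  have hφm : AEStronglyMeasurable φ (volume.restrict Ω) := φ.continuous.aestronglyMeasurable
  have hgm : AEStronglyMeasurable (gradient φ) (volume.restrict Ω) :=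
    (continuous_gradient_testFunction φ).aestronglyMeasurable
  have hEi : Integrable (fun x => ‖gradient φ x‖ ^ 2) (volume.restrict Ω) :=
    (memLp_gradient_testFunction φ 2).norm.integrable_sq
  set ε : ℕ → ℝ := fun n => 1 / ((n : ℝ) + 1)
  have hε : ∀ n, 0 < ε n := fun n => by positivity
  have hε0 : Tendsto ε atTop (𝓝 0) := tendsto_one_div_add_atTop_nhds_zero_nat
  set L : ℕ → ℝ → ℝ := fun n s => (regId (ε n) s)⁻¹ with hLdef
  have hPpos : ∀ n s, 0 < regId (ε n) s := fun n s =>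
    (div_pos (hε n) (by norm_num)).trans_le (le_regId (hε n) s)
  have hL : ∀ n, ContDiff ℝ ∞ (L n) := fun n =>
    (contDiff_regId (hε n)).inv fun s => (hPpos n s).ne'
  have hL' : ∀ n s, deriv (L n) s =
      -(s / √(ε n ^ 2 + s ^ 2) + ε n ^ 2 / (ε n ^ 2 + s ^ 2)) * L n s ^ 2 := fun n s => by
    rw [((hasDerivAt_regId (hε n) s).fun_inv (hPpos n s).ne').deriv]
    simp only [hLdef, inv_pow]
    ring
  have hL0 : ∀ n s, 0 < L n s := fun n s => inv_pos.mpr (hPpos n s)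
  have hLb : ∀ n s, L n s ≤ 4 / ε n := fun n s => by
    have := inv_anti₀ (div_pos (hε n) (by norm_num)) (le_regId (hε n) s)
    simpa using this
  have hbd : ∀ n, ∃ C, ∀ s, |L n s| ≤ C ∧ |deriv (L n) s| ≤ C := fun n => by
    refine ⟨max (4 / ε n) (2 * (4 / ε n) ^ 2), fun s => ⟨?_, ?_⟩⟩
    · rw [abs_of_pos (hL0 n s)]
      exact (hLb n s).trans (le_max_left _ _)
    · rw [hL', abs_mul, abs_neg, abs_of_nonneg (sq_nonneg (L n s))]
      refine le_trans ?_ (le_max_right _ _)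
      have := hLb n s
      have := (hL0 n s).le
      exact mul_le_mul (abs_deriv_regId_le (hε n) s) (by gcongr) (by positivity) (by norm_num)
  -- the Picone integrand at level `ε`, before the limit
  set a : ℕ → EuclideanSpace ℝ (Fin N) → ℝ := fun n x =>
    V x * u x * L n (u x) * φ x ^ 2 + ‖gradient φ x - (φ x * L n (u x)) • w x‖ ^ 2 with ha
  have ha0 : ∀ n, 0 ≤ᵐ[volume.restrict Ω] a n := fun n => by
    filter_upwards [hpos, hV] with x hx hVx
    have := (hL0 n (u x)).le
    simp only [ha, Pi.zero_apply]
    positivity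
  have ham : ∀ n, AEStronglyMeasurable (a n) (volume.restrict Ω) := fun n => by
    have h1 := (hL n).continuous.comp_aestronglyMeasurable hum
    exact ((hVu.1.mul h1).mul (hφm.pow 2)).add ((hgm.sub ((hφm.mul h1).smul hwm)).norm.pow 2)
  have hale : ∀ n, Integrable (a n) (volume.restrict Ω) ∧
      ∫ x in Ω, a n x ≤ ∫ x in Ω, ‖gradient φ x‖ ^ 2 := fun n => by
    obtain ⟨C, hC⟩ := hbd n
    obtain ⟨h1, h2⟩ := hu.integral_test_sq_mul_comp hVu hsol (hL n) hC φ
    obtain ⟨B, hB0, hB⟩ := exists_bound_testFunction φ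
    have hC0 : 0 ≤ C := (abs_nonneg _).trans (hC 0).1
    have h3 : Integrable (fun x => V x * u x * L n (u x) * φ x ^ 2) (volume.restrict Ω) := by
      refine (((hVu.abs.mul_const C).mul_const (B ^ 2))).mono'
        ((hVu.1.mul ((hL n).continuous.comp_aestronglyMeasurable hum)).mul (hφm.pow 2))
        (Eventually.of_forall fun x => ?_)
      rw [Real.norm_eq_abs, abs_mul, abs_mul _ (L n (u x)), abs_pow]
      have := (hC (u x)).1
      have := (hB x).1
      gcongr
    have h4 := (h3.sub h1).add hEi
    have hle : a n ≤ᵐ[volume.restrict Ω] fun x => V x * u x * L n (u x) * φ x ^ 2 -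
        (2 * φ x * L n (u x) * inner ℝ (w x) (gradient φ x) +
          φ x ^ 2 * deriv (L n) (u x) * ‖w x‖ ^ 2) + ‖gradient φ x‖ ^ 2 := by
      filter_upwards [hpos] with x hx
      -- `(regId ε)' ≥ 1` means `-L' ≥ L²`, which completes the square `‖∇φ - φ L(u) w‖²`
      have h5 := one_le_deriv_regId (hε n) hx
      have h6 : 0 ≤ φ x ^ 2 * L n (u x) ^ 2 * ‖w x‖ ^ 2 := by positivity
      have h7 := mul_le_mul_of_nonneg_right h5 h6
      simp only [ha]
      rw [norm_sub_sq_real, norm_smul, inner_smul_right, real_inner_comm, hL', mul_pow,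
        Real.norm_eq_abs, sq_abs, mul_pow]
      linarith
    have h8 : Integrable (a n) (volume.restrict Ω) := by
      refine h4.mono' (ham n) ?_
      filter_upwards [hle, ha0 n] with x hx hx0
      rw [Real.norm_of_nonneg hx0]
      exact hx
    refine ⟨h8, (integral_mono_ae h8 h4 hle).trans (le_of_eq ?_)⟩
    have e1 := integral_add (h3.sub h1) hEi
    have e2 := integral_sub h3 h1
    simp only [Pi.sub_apply, Pi.add_apply] at e1 e2 ⊢
    rw [e1, e2, h2, sub_self, zero_add]
  set b : EuclideanSpace ℝ (Fin N) → ℝ := fun x =>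
    V x * φ x ^ 2 + ‖gradient φ x - (φ x / u x) • w x‖ ^ 2 with hb
  have hlim : ∀ᵐ x ∂(volume.restrict (Ω : Set (EuclideanSpace ℝ (Fin N)))),
      Tendsto (fun n => a n x) atTop (𝓝 (b x)) := by
    filter_upwards [hpos] with x hx
    have h1 : Tendsto (fun n => L n (u x)) atTop (𝓝 (u x)⁻¹) :=
      (tendsto_regId hε0 hx).inv₀ hx.ne'
    have h2 := ((h1.const_mul (V x * u x)).mul_const (φ x ^ 2)).add
      ((((h1.const_mul (φ x)).smul_const (w x)).const_sub (gradient φ x)).norm.pow 2)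
    rwa [mul_assoc (V x), mul_inv_cancel₀ hx.ne', mul_one, ← div_eq_mul_inv] at h2
  have hb0 : 0 ≤ᵐ[volume.restrict Ω] b := by
    filter_upwards [hV] with x hVx
    simp only [hb, Pi.zero_apply]
    positivity
  have hbm : AEStronglyMeasurable b (volume.restrict Ω) :=
    aestronglyMeasurable_of_tendsto_ae atTop ham hlim
  have hfatou : ∫⁻ x in Ω, ENNReal.ofReal (b x) ≤
      ENNReal.ofReal (∫ x in Ω, ‖gradient φ x‖ ^ 2) := by
    calc ∫⁻ x in Ω, ENNReal.ofReal (b x)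
        = ∫⁻ x in Ω, liminf (fun n => ENNReal.ofReal (a n x)) atTop := by
          refine lintegral_congr_ae ?_
          filter_upwards [hlim] with x hx
          exact ((ENNReal.continuous_ofReal.tendsto _).comp hx).liminf_eq.symm
      _ ≤ liminf (fun n => ∫⁻ x in Ω, ENNReal.ofReal (a n x)) atTop :=
          lintegral_liminf_le' fun n => (ham n).aemeasurable.ennreal_ofReal
      _ ≤ _ := by
          refine liminf_le_of_frequently_le
            (Eventually.frequently (Eventually.of_forall fun n => ?_))
          rw [← ofReal_integral_eq_lintegral_ofReal (hale n).1 (ha0 n)]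
          exact ENNReal.ofReal_le_ofReal (hale n).2
  have hbi : Integrable b (volume.restrict Ω) :=
    ⟨hbm, (hasFiniteIntegral_iff_ofReal hb0).mpr (hfatou.trans_lt ENNReal.ofReal_lt_top)⟩
  have hVφ : Integrable (fun x => V x * φ x ^ 2) (volume.restrict Ω) := by
    refine hbi.mono' (hVm.mul (hφm.pow 2)) ?_
    filter_upwards [hV] with x hVx
    rw [Real.norm_of_nonneg (by positivity)]
    exact le_add_of_nonneg_right (sq_nonneg _)
  have hR : Integrable (fun x => ‖gradient φ x - (φ x / u x) • w x‖ ^ 2) (volume.restrict Ω) := by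
    refine (hbi.sub hVφ).congr (Eventually.of_forall fun x => ?_)
    simp [hb]
  refine ⟨hVφ, hR, ?_⟩
  rw [← integral_add hVφ hR]
  rw [← ofReal_integral_eq_lintegral_ofReal hbi hb0] at hfatou
  exact (ENNReal.ofReal_le_ofReal_iff (integral_nonneg fun x => by positivity)).mp hfatou

/-- Control of `∇φ` near the level set `{u = s₀}`: its energy there is small, of order `δ`, up to
the Picone remainder. It follows from the equation tested with `φ² stepFun s₀ δ u`, in which
`φ ∇u` is replaced by `u ∇φ` up to that remainder. -/
theorem MemH10.integral_step_le (hu : MemH10 Ω u w)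
    (hpos : ∀ᵐ x ∂(volume.restrict (Ω : Set (EuclideanSpace ℝ (Fin N)))), 0 < u x)
    (hVm : AEStronglyMeasurable V (volume.restrict Ω))
    (hV : ∀ᵐ x ∂(volume.restrict (Ω : Set (EuclideanSpace ℝ (Fin N)))), 0 ≤ V x)
    (hVu : Integrable (fun x => V x * u x) (volume.restrict Ω))
    (hsol : ∀ φ : 𝓓(Ω, ℝ), ∫ x in Ω, inner ℝ (w x) (gradient φ x) = ∫ x in Ω, V x * u x * φ x)
    {s₀ δ : ℝ} (hδ : 0 < δ) (hδ1 : δ ≤ 1) (φ : 𝓓(Ω, ℝ)) :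
    Integrable (fun x => u x ^ 2 / (1 + u x ^ 2) * (1 + ((u x - s₀) / δ) ^ 2)⁻¹ *
      ‖gradient φ x‖ ^ 2) (volume.restrict Ω) ∧
    ∫ x in Ω, u x ^ 2 / (1 + u x ^ 2) * (1 + ((u x - s₀) / δ) ^ 2)⁻¹ * ‖gradient φ x‖ ^ 2 ≤
      3 * δ * (∫ x in Ω, ‖gradient φ x‖ ^ 2) +
        (9 + 121 / δ) * ∫ x in Ω, ‖gradient φ x - (φ x / u x) • w x‖ ^ 2 := by
  obtain ⟨hVφ, hR, hle⟩ := hu.picone hpos hVm hV hVu hsol φ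
  have hum := hu.memLp.1
  have hEi : Integrable (fun x => ‖gradient φ x‖ ^ 2) (volume.restrict Ω) :=
    (memLp_gradient_testFunction φ 2).norm.integrable_sq
  have hE0 : 0 ≤ ∫ x in Ω, ‖gradient φ x‖ ^ 2 := integral_nonneg fun x => by positivity
  have hR0 : 0 ≤ ∫ x in Ω, ‖gradient φ x - (φ x / u x) • w x‖ ^ 2 :=
    integral_nonneg fun x => by positivity
  obtain ⟨h1, h2⟩ := hu.integral_test_sq_mul_comp hVu hsol (contDiff_stepFun (s₀ := s₀) (δ := δ))
    (fun s => ⟨abs_stepFun_le hδ s, abs_deriv_stepFun_le hδ s⟩) φ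
  have hk : Integrable (fun x => u x ^ 2 / (1 + u x ^ 2) * (1 + ((u x - s₀) / δ) ^ 2)⁻¹ *
      ‖gradient φ x‖ ^ 2) (volume.restrict Ω) := by
    have hc : Continuous fun s : ℝ => s ^ 2 / (1 + s ^ 2) * (1 + ((s - s₀) / δ) ^ 2)⁻¹ := by
      refine ((continuous_pow 2).div (by fun_prop) fun s => by positivity).mul
        (Continuous.inv₀ (by fun_prop) fun s => by positivity)
    refine hEi.mono' ((hc.comp_aestronglyMeasurable hum).mul hEi.1)
      (Eventually.of_forall fun x => ?_)
    rw [Real.norm_of_nonneg (by positivity)]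
    refine mul_le_of_le_one_left (by positivity) (mul_le_one₀ ?_ (by positivity) ?_)
    · rw [div_le_one (by positivity)]
      linarith
    · exact inv_le_one_of_one_le₀ (by nlinarith [sq_nonneg ((u x - s₀) / δ)])
  refine ⟨hk, ?_⟩
  have hpt : ∀ᵐ x ∂(volume.restrict (Ω : Set (EuclideanSpace ℝ (Fin N)))),
      u x ^ 2 / (1 + u x ^ 2) * (1 + ((u x - s₀) / δ) ^ 2)⁻¹ * ‖gradient φ x‖ ^ 2 ≤
        (2 * φ x * stepFun s₀ δ (u x) * inner ℝ (w x) (gradient φ x) +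
          φ x ^ 2 * deriv (stepFun s₀ δ) (u x) * ‖w x‖ ^ 2) +
        (δ * ‖gradient φ x‖ ^ 2 +
          (9 + 121 / δ) * ‖gradient φ x - (φ x / u x) • w x‖ ^ 2) := by
    filter_upwards [hpos] with x hx
    have hp1 := self_mul_stepFun_le (s₀ := s₀) hδ hx
    have hp0 := mul_nonneg hx.le (stepFun_nonneg (s₀ := s₀) hδ (u x))
    have hq := abs_le.mp (abs_sq_mul_deriv_stepFun_le (s₀ := s₀) hδ hδ1 hx)
    have hK := mul_le_mul_of_nonneg_right (two_mul_self_mul_stepFun_add (s₀ := s₀) hδ hx)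
      (sq_nonneg ‖gradient φ x‖)
    set r := gradient φ x - (φ x / u x) • w x with hr
    -- `Y = ⟨r, ∇φ⟩`, and `X`, `Z` express the two terms of the tested equation through `r`
    obtain ⟨Y, hY⟩ : ∃ Y, Y = inner ℝ r (gradient φ x) := ⟨_, rfl⟩
    have hX : φ x * inner ℝ (w x) (gradient φ x) = u x * (‖gradient φ x‖ ^ 2 - Y) := by
      rw [hY, hr, inner_sub_left, real_inner_self_eq_norm_sq, real_inner_smul_left]
      field_simp
      ring
    have hZ : φ x ^ 2 * ‖w x‖ ^ 2 = u x ^ 2 * (‖r‖ ^ 2 + ‖gradient φ x‖ ^ 2 - 2 * Y) := by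
      have h3 : ‖gradient φ x - r‖ ^ 2 = ‖r‖ ^ 2 + ‖gradient φ x‖ ^ 2 - 2 * Y := by
        rw [norm_sub_sq_real, hY, real_inner_comm]
        ring
      rw [← h3, hr, sub_sub_cancel, norm_smul, Real.norm_eq_abs, mul_pow, sq_abs]
      field_simp
    have hYb : |Y| ≤ ‖r‖ * ‖gradient φ x‖ := hY ▸ abs_real_inner_le_norm _ _
    have hYoung : 22 * (‖r‖ * ‖gradient φ x‖) ≤ δ * ‖gradient φ x‖ ^ 2 + 121 / δ * ‖r‖ ^ 2 := by
      have h4 : 0 ≤ (δ * ‖gradient φ x‖ - 11 * ‖r‖) ^ 2 / δ := by positivity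
      have h5 : (δ * ‖gradient φ x‖ - 11 * ‖r‖) ^ 2 / δ = δ * ‖gradient φ x‖ ^ 2 +
          121 / δ * ‖r‖ ^ 2 - 22 * (‖r‖ * ‖gradient φ x‖) := by
        field_simp
        ring
      linarith
    set p := u x * stepFun s₀ δ (u x) with hp
    set q := u x ^ 2 * deriv (stepFun s₀ δ) (u x) with hq'
    have hpq : |2 * (p + q) * Y| ≤ 22 * (‖r‖ * ‖gradient φ x‖) := by
      rw [abs_mul]
      refine mul_le_mul ?_ hYb (abs_nonneg _) (by norm_num)
      rw [abs_le]
      constructor <;> linarith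
    have hqR := mul_le_mul_of_nonneg_right hq.1 (sq_nonneg ‖r‖)
    have hid : 2 * φ x * stepFun s₀ δ (u x) * inner ℝ (w x) (gradient φ x) +
        φ x ^ 2 * deriv (stepFun s₀ δ) (u x) * ‖w x‖ ^ 2 =
        (2 * p + q) * ‖gradient φ x‖ ^ 2 - 2 * (p + q) * Y + q * ‖r‖ ^ 2 := by
      calc _ = 2 * stepFun s₀ δ (u x) * (φ x * inner ℝ (w x) (gradient φ x)) +
            deriv (stepFun s₀ δ) (u x) * (φ x ^ 2 * ‖w x‖ ^ 2) := by ring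
        _ = _ := by
          rw [hX, hZ, hp, hq']
          ring
    rw [hid]
    have := (abs_le.mp hpq).2
    linarith
  have hVL : ∫ x in Ω, V x * u x * stepFun s₀ δ (u x) * φ x ^ 2 ≤
      2 * δ * ∫ x in Ω, V x * φ x ^ 2 := by
    rw [← integral_const_mul]
    refine integral_mono_of_nonneg ?_ (hVφ.const_mul _) ?_
    · filter_upwards [hpos, hV] with x hx hVx
      have := stepFun_nonneg (s₀ := s₀) hδ (u x)
      simp only [Pi.zero_apply]
      positivity
    · filter_upwards [hpos, hV] with x hx hVx
      have h3 := mul_le_mul_of_nonneg_right (self_mul_stepFun_le (s₀ := s₀) hδ hx)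
        (mul_nonneg hVx (sq_nonneg (φ x)))
      linarith
  have hint := integral_mono_ae hk (h1.add ((hEi.const_mul δ).add (hR.const_mul (9 + 121 / δ)))) hpt
  have e1 := integral_add h1 ((hEi.const_mul δ).add (hR.const_mul (9 + 121 / δ)))
  have e2 := integral_add (hEi.const_mul δ) (hR.const_mul (9 + 121 / δ))
  simp only [Pi.add_apply] at hint e1 e2
  rw [e1, e2, h2, integral_const_mul, integral_const_mul] at hint
  have hVE := mul_le_mul_of_nonneg_left (a := 2 * δ) (le_of_add_le_of_nonneg_left hle hR0)
    (by positivity)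
  linarith

/-- Strict spectral gap: if `V ≥ Λ` and `V - Λ` is bounded away from `0` off each neighbourhood of
the level set `{u = s₀}`, then the Dirichlet form on `Ω` is bounded below by more than `Λ`. -/
theorem MemH10.exists_gap (hN : 0 < N)
    (hΩ : Bornology.IsBounded (Ω : Set (EuclideanSpace ℝ (Fin N))))
    (hu : MemH10 Ω u w)
    (hpos : ∀ᵐ x ∂(volume.restrict (Ω : Set (EuclideanSpace ℝ (Fin N)))), 0 < u x)
    (hVm : AEStronglyMeasurable V (volume.restrict Ω))
    (hVu : Integrable (fun x => V x * u x) (volume.restrict Ω))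
    (hsol : ∀ φ : 𝓓(Ω, ℝ), ∫ x in Ω, inner ℝ (w x) (gradient φ x) = ∫ x in Ω, V x * u x * φ x)
    {Λ s₀ : ℝ} (hΛ : 0 ≤ Λ) (hs₀ : 0 < s₀)
    (hVΛ : ∀ᵐ x ∂(volume.restrict (Ω : Set (EuclideanSpace ℝ (Fin N)))), Λ ≤ V x)
    (hgap : ∀ δ > 0, ∃ ε > 0, ∀ᵐ x ∂(volume.restrict (Ω : Set (EuclideanSpace ℝ (Fin N)))),
      δ ≤ |u x - s₀| → Λ + ε ≤ V x) :
    ∃ κ > 0, ∀ φ : 𝓓(Ω, ℝ),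
      (Λ + κ) * ∫ x in Ω, φ x ^ 2 ≤ ∫ x in Ω, ‖gradient φ x‖ ^ 2 := by
  obtain ⟨D, hD0, hD⟩ := hΩ.exists_pos_norm_le
  have hV : ∀ᵐ x ∂(volume.restrict (Ω : Set (EuclideanSpace ℝ (Fin N)))), 0 ≤ V x :=
    hVΛ.mono fun x hx => hΛ.trans hx
  set c : ℝ := (s₀ / 2) ^ 2 / (1 + (s₀ / 2) ^ 2) / 2 with hc
  have hc0 : 0 < c := by positivity
  -- the total coefficient allowed in front of `∫ |∇φ|²`; all that matters is `τ Λ < 1 / 2`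
  set τ : ℝ := 1 / (4 * (Λ + 1)) with hτ
  have hτ0 : 0 < τ := by positivity
  have hτΛ : τ * Λ < 1 / 2 := by
    rw [hτ, one_div_mul_eq_div, div_lt_div_iff₀ (by positivity) (by norm_num)]
    linarith
  set δ : ℝ := min 1 (min (s₀ / 2) (c * τ / (12 * D ^ 2))) with hδ
  have hδ0 : 0 < δ := by positivity
  have hδ1 : δ ≤ 1 := min_le_left _ _
  have hδ2 : δ ≤ s₀ / 2 := (min_le_right _ _).trans (min_le_left _ _)
  have hδ3 : 2 * D ^ 2 / c * (3 * δ) ≤ τ / 2 := by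
    have h1 : δ ≤ c * τ / (12 * D ^ 2) := (min_le_right _ _).trans (min_le_right _ _)
    rw [le_div_iff₀ (by positivity)] at h1
    rw [div_mul_eq_mul_div, div_le_iff₀ hc0]
    linarith
  obtain ⟨ε, hε, hgapε⟩ := hgap δ hδ0
  set A₁ : ℝ := 2 * D ^ 2 / c * (9 + 121 / δ) with hA₁
  set A₂ : ℝ := D ^ 2 / (τ / 2 * ε) with hA₂
  have hA₁0 : 0 < A₁ := by positivity
  have hA₂0 : 0 < A₂ := by positivity
  clear_value c τ δ A₁ A₂
  refine ⟨(1 / 2 - τ * Λ) / (τ + (A₁ + A₂)), div_pos (by linarith) (by positivity), fun φ => ?_⟩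
  obtain ⟨hVφ, hR, hle⟩ := hu.picone hpos hVm hV hVu hsol φ
  obtain ⟨hk, hkle⟩ := hu.integral_step_le (s₀ := s₀) hpos hVm hV hVu hsol hδ0 hδ1 φ
  have hEi : Integrable (fun x => ‖gradient φ x‖ ^ 2) (volume.restrict Ω) :=
    (memLp_gradient_testFunction φ 2).norm.integrable_sq
  have hMi : Integrable (fun x => φ x ^ 2) (volume.restrict Ω) :=
    (memLp_testFunction φ 2).integrable_sq
  have hSi : Integrable (fun x => (V x - Λ) * φ x ^ 2) (volume.restrict Ω) := by
    simp only [sub_mul]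
    exact hVφ.sub (hMi.const_mul Λ)
  have hS : ∫ x in Ω, (V x - Λ) * φ x ^ 2 =
      (∫ x in Ω, V x * φ x ^ 2) - Λ * ∫ x in Ω, φ x ^ 2 := by
    simp only [sub_mul]
    rw [integral_sub hVφ (hMi.const_mul Λ), integral_const_mul]
  have hS0 : 0 ≤ ∫ x in Ω, (V x - Λ) * φ x ^ 2 := by
    refine integral_nonneg_of_ae ?_
    filter_upwards [hVΛ] with x hx
    exact mul_nonneg (sub_nonneg.mpr hx) (sq_nonneg _)
  have hR0 : 0 ≤ ∫ x in Ω, ‖gradient φ x - (φ x / u x) • w x‖ ^ 2 :=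
    integral_nonneg fun x => by positivity
  have hPoinc := integral_sq_le_integral_mul_gradient hN φ hD
  have hpt : ∀ᵐ x ∂(volume.restrict (Ω : Set (EuclideanSpace ℝ (Fin N)))),
      2 * D * (|φ x| * ‖gradient φ x‖) ≤ 1 / 2 * φ x ^ 2 + (2 * D ^ 2 / c *
        (u x ^ 2 / (1 + u x ^ 2) * (1 + ((u x - s₀) / δ) ^ 2)⁻¹ * ‖gradient φ x‖ ^ 2) +
        (τ / 2 * ‖gradient φ x‖ ^ 2 + A₂ * ((V x - Λ) * φ x ^ 2))) := by
    filter_upwards [hpos, hVΛ, hgapε] with x hx hVx hfar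
    have hφ2 : |φ x| ^ 2 = φ x ^ 2 := sq_abs _
    have hn1 : 0 ≤ 2 * D ^ 2 / c * (u x ^ 2 / (1 + u x ^ 2) * (1 + ((u x - s₀) / δ) ^ 2)⁻¹ *
        ‖gradient φ x‖ ^ 2) := by positivity
    have hn2 : 0 ≤ A₂ * ((V x - Λ) * φ x ^ 2) :=
      mul_nonneg hA₂0.le (mul_nonneg (sub_nonneg.mpr hVx) (sq_nonneg _))
    have hn3 : 0 ≤ τ / 2 * ‖gradient φ x‖ ^ 2 := by positivity
    rcases lt_or_ge |u x - s₀| δ with hnear | hge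
    · -- near the level set the step function has slope at least `c`
      have hs : s₀ / 2 ≤ u x := by linarith [(abs_lt.mp hnear).1]
      have h1 : (s₀ / 2) ^ 2 / (1 + (s₀ / 2) ^ 2) ≤ u x ^ 2 / (1 + u x ^ 2) := by
        rw [div_le_div_iff₀ (by positivity) (by positivity)]
        have := pow_le_pow_left₀ (by positivity) hs 2
        linarith
      have h2 : (2 : ℝ)⁻¹ ≤ (1 + ((u x - s₀) / δ) ^ 2)⁻¹ := by
        refine inv_anti₀ (by positivity) ?_
        have : ((u x - s₀) / δ) ^ 2 ≤ 1 := by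
          rw [sq_le_one_iff_abs_le_one, abs_div, abs_of_pos hδ0, div_le_one hδ0]
          exact hnear.le
        linarith
      have h3 : c ≤ u x ^ 2 / (1 + u x ^ 2) * (1 + ((u x - s₀) / δ) ^ 2)⁻¹ := by
        rw [hc, div_eq_mul_inv _ (2 : ℝ)]
        exact mul_le_mul h1 h2 (by norm_num) (by positivity)
      have h4 : 2 * D ^ 2 * ‖gradient φ x‖ ^ 2 ≤ 2 * D ^ 2 / c *
          (u x ^ 2 / (1 + u x ^ 2) * (1 + ((u x - s₀) / δ) ^ 2)⁻¹ * ‖gradient φ x‖ ^ 2) := by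
        calc _ = 2 * D ^ 2 / c * (c * ‖gradient φ x‖ ^ 2) := by field_simp
          _ ≤ _ := by gcongr
      have h5 : (|φ x| - 2 * D * ‖gradient φ x‖) ^ 2 = φ x ^ 2 -
          4 * D * (|φ x| * ‖gradient φ x‖) + 4 * D ^ 2 * ‖gradient φ x‖ ^ 2 := by
        rw [← hφ2]
        ring
      have h6 := sq_nonneg (|φ x| - 2 * D * ‖gradient φ x‖)
      rw [h5] at h6
      linarith
    · have h1 := hfar hge
      have h2 : D ^ 2 / (τ / 2) * φ x ^ 2 ≤ A₂ * ((V x - Λ) * φ x ^ 2) := by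
        calc _ = A₂ * (ε * φ x ^ 2) := by rw [hA₂]; field_simp
          _ ≤ _ := by
            gcongr
            linarith
      have h3 : 0 ≤ (τ / 2 * ‖gradient φ x‖ - D * |φ x|) ^ 2 / (τ / 2) := by positivity
      have h4 : (τ / 2 * ‖gradient φ x‖ - D * |φ x|) ^ 2 / (τ / 2) =
          τ / 2 * ‖gradient φ x‖ ^ 2 + D ^ 2 / (τ / 2) * φ x ^ 2 -
            2 * D * (|φ x| * ‖gradient φ x‖) := by
        rw [← hφ2]
        field_simp
        ring
      rw [h4] at h3
      linarith [sq_nonneg (φ x)]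
  have hi3 := (hEi.const_mul (τ / 2)).add (hSi.const_mul A₂)
  have hi2 := (hk.const_mul (2 * D ^ 2 / c)).add hi3
  have hi1 := (hMi.const_mul (1 / 2)).add hi2
  have hint := integral_mono_of_nonneg
    (Eventually.of_forall fun x => by simp only [Pi.zero_apply]; positivity) hi1 hpt
  have e1 := integral_add (hMi.const_mul (1 / 2)) hi2
  have e2 := integral_add (hk.const_mul (2 * D ^ 2 / c)) hi3
  have e3 := integral_add (hEi.const_mul (τ / 2)) (hSi.const_mul A₂)
  simp only [Pi.add_apply] at hint e1 e2 e3
  rw [e1, e2, e3] at hint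
  simp only [integral_const_mul] at hint
  set M := ∫ x in Ω, φ x ^ 2
  set E := ∫ x in Ω, ‖gradient φ x‖ ^ 2
  set R := ∫ x in Ω, ‖gradient φ x - (φ x / u x) • w x‖ ^ 2
  set S := ∫ x in Ω, (V x - Λ) * φ x ^ 2
  have hE0 : 0 ≤ E := integral_nonneg fun x => by positivity
  have h1 := mul_le_mul_of_nonneg_left hkle (by positivity : 0 ≤ 2 * D ^ 2 / c)
  have h2 := mul_le_mul_of_nonneg_right hδ3 hE0
  have h3 : 2 * D ^ 2 / c * (3 * δ * E + (9 + 121 / δ) * R) =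
      2 * D ^ 2 / c * (3 * δ) * E + A₁ * R := by
    rw [hA₁]
    ring
  have hRS : R + S ≤ E - Λ * M := by linarith
  have h4 : A₁ * R ≤ A₁ * (E - Λ * M) := mul_le_mul_of_nonneg_left (by linarith) hA₁0.le
  have h5 : A₂ * S ≤ A₂ * (E - Λ * M) := mul_le_mul_of_nonneg_left (by linarith) hA₂0.le
  have h6 : (Λ + (1 / 2 - τ * Λ) / (τ + (A₁ + A₂))) * M =
      (1 / 2 + (A₁ + A₂) * Λ) * M / (τ + (A₁ + A₂)) := by
    field_simp
    ring
  rw [h6, div_le_iff₀ (by positivity)]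
  linarith

/-- The spectral gap passes from test functions to `H¹₀(Ω)`. -/
theorem MemH10.mul_integral_sq_le {v : EuclideanSpace ℝ (Fin N) → ℝ}
    {G : EuclideanSpace ℝ (Fin N) → EuclideanSpace ℝ (Fin N)} (hv : MemH10 Ω v G) {c : ℝ}
    (hc : 0 ≤ c)
    (h : ∀ φ : 𝓓(Ω, ℝ), c * ∫ x in Ω, φ x ^ 2 ≤ ∫ x in Ω, ‖gradient φ x‖ ^ 2) :
    c * ∫ x in Ω, v x ^ 2 ≤ ∫ x in Ω, ‖G x‖ ^ 2 := by
  obtain ⟨ψ, h1, h2, -⟩ := hv.exists_seq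
  have hnorm : ∀ {F : Type} [NormedAddCommGroup F] {f : EuclideanSpace ℝ (Fin N) → F},
      MemLp f 2 (volume.restrict Ω) →
      eLpNorm f 2 (volume.restrict Ω) = ENNReal.ofReal √(∫ x in Ω, ‖f x‖ ^ 2) := fun hf => by
    rw [hf.eLpNorm_eq_integral_rpow_norm (by norm_num) (by norm_num)]
    simp [Real.sqrt_eq_rpow]
  have hψ : ∀ φ : 𝓓(Ω, ℝ), ENNReal.ofReal √c * eLpNorm φ 2 (volume.restrict Ω) ≤
      eLpNorm (gradient φ) 2 (volume.restrict Ω) := fun φ => by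
    rw [hnorm (memLp_testFunction φ 2), hnorm (memLp_gradient_testFunction φ 2),
      ← ENNReal.ofReal_mul (Real.sqrt_nonneg _), ← Real.sqrt_mul hc]
    refine ENNReal.ofReal_le_ofReal (Real.sqrt_le_sqrt ?_)
    simpa using h φ
  have hle : ∀ k, ENNReal.ofReal √c * eLpNorm v 2 (volume.restrict Ω) ≤
      eLpNorm G 2 (volume.restrict Ω) +
        eLpNorm (fun x => G x - gradient (ψ k) x) 2 (volume.restrict Ω) +
        ENNReal.ofReal √c * eLpNorm (fun x => v x - ψ k x) 2 (volume.restrict Ω) := fun k => by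
    have h3 := eLpNorm_add_le (p := 2) (hv.memLp.1.sub (memLp_testFunction (ψ k) 2).1)
      (memLp_testFunction (ψ k) 2).1 (by norm_num)
    have h4 := eLpNorm_sub_le (p := 2) hv.memLp_grad.1
      (hv.memLp_grad.1.sub (memLp_gradient_testFunction (ψ k) 2).1) (by norm_num)
    rw [sub_add_cancel] at h3
    rw [sub_sub_cancel] at h4
    calc _ ≤ _ := mul_le_mul_right h3 _
      _ = _ := mul_add _ _ _
      _ ≤ _ := add_le_add_right ((hψ (ψ k)).trans h4) _
      _ = _ := add_comm _ _
  have hlim : Tendsto (fun k => eLpNorm G 2 (volume.restrict Ω) +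
        eLpNorm (fun x => G x - gradient (ψ k) x) 2 (volume.restrict Ω) +
        ENNReal.ofReal √c * eLpNorm (fun x => v x - ψ k x) 2 (volume.restrict Ω)) atTop
      (𝓝 (eLpNorm G 2 (volume.restrict Ω))) := by
    have := (h2.const_add (eLpNorm G 2 (volume.restrict Ω))).add
      (ENNReal.Tendsto.const_mul (a := ENNReal.ofReal √c) h1 (Or.inr (by simp)))
    simpa using this
  have hfin := ge_of_tendsto' hlim hle
  rw [hnorm hv.memLp, hnorm hv.memLp_grad, ← ENNReal.ofReal_mul (Real.sqrt_nonneg _),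
    ← Real.sqrt_mul hc, ENNReal.ofReal_le_ofReal_iff (Real.sqrt_nonneg _),
    Real.sqrt_le_sqrt_iff (integral_nonneg fun x => by positivity)] at hfin
  simpa using hfin

end SpectralGap

/-! ### The potential of the nonlinearity -/

section Potential

/-- The potential `V(s) = f(s) / s`, `s > 0`, of the nonlinearity `f = logCriticalNonlinearity`; the
equation for a positive `u` reads `-Δu = V(u) u`. -/
noncomputable def logCriticalPotential (N : ℕ) (lam mu s : ℝ) : ℝ :=
  s ^ (criticalExponent N - 2) + lam + mu * Real.log (s ^ 2)

variable {N : ℕ} {lam mu : ℝ}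

theorem criticalExponent_sub_two (hN : 3 ≤ N) :
    criticalExponent N - 2 = 4 / ((N : ℝ) - 2) := by
  have hN' : (3 : ℝ) ≤ N := by exact_mod_cast hN
  have : (N : ℝ) - 2 ≠ 0 := by linarith
  rw [criticalExponent]
  field_simp
  ring

theorem logCriticalNonlinearity_eq {s : ℝ} (hs : 0 < s) :
    logCriticalNonlinearity N lam mu s = logCriticalPotential N lam mu s * s := by
  rw [logCriticalNonlinearity, logCriticalPotential, abs_of_pos hs]
  ring

theorem measurable_logCriticalPotential : Measurable (logCriticalPotential N lam mu) := by
  unfold logCriticalPotential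
  fun_prop

theorem abs_logCriticalPotential_mul_le (hN : 3 ≤ N) {s : ℝ} (hs : 0 < s) :
    |logCriticalPotential N lam mu s * s| ≤
      1 + s ^ criticalExponent N + |lam| * s + |mu| * (2 * (1 + s ^ 2)) := by
  have hN' : (3 : ℝ) ≤ N := by exact_mod_cast hN
  have hp : 0 < criticalExponent N - 2 := by
    rw [criticalExponent_sub_two hN]
    exact div_pos (by norm_num) (by linarith)
  have h1 : s ^ (criticalExponent N - 2) * s ≤ 1 + s ^ criticalExponent N := by
    rw [← Real.rpow_add_one hs.ne']
    rcases le_total s 1 with h | h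
    · have := Real.rpow_le_one hs.le h (by linarith : 0 ≤ criticalExponent N - 2 + 1)
      linarith [Real.rpow_nonneg hs.le (criticalExponent N)]
    · have := Real.rpow_le_rpow_of_exponent_le h
        (by linarith : criticalExponent N - 2 + 1 ≤ criticalExponent N)
      linarith
  have h2 : |Real.log (s ^ 2) * s| ≤ 2 * (1 + s ^ 2) := by
    have h3 := Real.log_le_sub_one_of_pos hs
    have h4 := Real.one_sub_inv_le_log_of_pos hs
    have h5 : (1 - s⁻¹) * s = s - 1 := by field_simp
    have h6 := mul_le_mul_of_nonneg_right h3 hs.le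
    have h7 := mul_le_mul_of_nonneg_right h4 hs.le
    rw [h5] at h7
    rw [Real.log_pow, Nat.cast_two, abs_le]
    constructor <;> nlinarith
  have h8 : logCriticalPotential N lam mu s * s = s ^ (criticalExponent N - 2) * s + lam * s +
      mu * (Real.log (s ^ 2) * s) := by
    rw [logCriticalPotential]
    ring
  rw [h8]
  refine (abs_add_le _ _).trans (add_le_add ((abs_add_le _ _).trans (add_le_add ?_ ?_)) ?_)
  · rwa [abs_of_nonneg (by positivity)]
  · rw [abs_mul, abs_of_pos hs]
  · rw [abs_mul]
    gcongr

/-- Quantitative minimum of the potential, from `log x ≤ 2 (√x - 1)`: with `a = -(N-2)μ/2`, the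
minimum is `a - a log a + λ`, attained where `s ^ (2* - 2) = a`. -/
theorem add_le_logCriticalPotential (hN : 3 ≤ N) (hmu : mu < 0) {a : ℝ}
    (ha : a = -(((N : ℝ) - 2) * mu / 2)) {s : ℝ} (hs : 0 < s) :
    a - a * Real.log a + lam + a * (√(s ^ (criticalExponent N - 2) / a) - 1) ^ 2 ≤
      logCriticalPotential N lam mu s := by
  have hN' : (3 : ℝ) ≤ N := by exact_mod_cast hN
  have ha0 : 0 < a := by rw [ha]; nlinarith
  have hT : 0 < s ^ (criticalExponent N - 2) := Real.rpow_pos_of_pos hs _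
  have hlogT : mu * Real.log (s ^ 2) = -a * Real.log (s ^ (criticalExponent N - 2)) := by
    have : (N : ℝ) - 2 ≠ 0 := by linarith
    rw [Real.log_rpow hs, criticalExponent_sub_two hN, ha, Real.log_pow]
    push_cast
    field_simp
    ring
  rw [logCriticalPotential, hlogT]
  set T := s ^ (criticalExponent N - 2)
  have hx : 0 < T / a := by positivity
  have hsq : √(T / a) ^ 2 = T / a := Real.sq_sqrt hx.le
  have h1 := Real.log_le_sub_one_of_pos (Real.sqrt_pos.mpr hx)
  rw [Real.log_sqrt hx.le, Real.log_div hT.ne' ha0.ne'] at h1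
  have h2 : a * (√(T / a) - 1) ^ 2 = T + a - 2 * a * √(T / a) := by
    rw [sub_sq, hsq]
    field_simp
    ring
  rw [h2]
  nlinarith

/-- Away from its minimum point the potential exceeds its minimum by a definite amount. -/
theorem exists_add_le_logCriticalPotential (hN : 3 ≤ N) (hmu : mu < 0) {a : ℝ}
    (ha : a = -(((N : ℝ) - 2) * mu / 2)) {δ : ℝ} (hδ : 0 < δ) :
    ∃ ε > 0, ∀ s > 0, δ ≤ |s - a ^ (criticalExponent N - 2)⁻¹| →
      a - a * Real.log a + lam + ε ≤ logCriticalPotential N lam mu s := by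
  have hN' : (3 : ℝ) ≤ N := by exact_mod_cast hN
  have ha0 : 0 < a := by rw [ha]; nlinarith
  have hp : 0 < criticalExponent N - 2 := by
    rw [criticalExponent_sub_two hN]
    exact div_pos (by norm_num) (by linarith)
  -- `s` is a continuous function of `z = √(s ^ (2* - 2) / a)`
  have hc : ContinuousAt (fun z : ℝ => (a * z ^ 2) ^ (criticalExponent N - 2)⁻¹) 1 :=
    ContinuousAt.rpow_const (by fun_prop) (Or.inr (by positivity))
  obtain ⟨ρ, hρ, hc⟩ := Metric.continuousAt_iff.mp hc δ hδ
  refine ⟨a * ρ ^ 2, by positivity, fun s hs hfar => ?_⟩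
  refine le_trans ?_ (add_le_logCriticalPotential hN hmu ha hs)
  set z := √(s ^ (criticalExponent N - 2) / a) with hz
  have hzs : (a * z ^ 2) ^ (criticalExponent N - 2)⁻¹ = s := by
    rw [hz, Real.sq_sqrt (by positivity), mul_div_cancel₀ _ ha0.ne',
      Real.rpow_rpow_inv hs.le hp.ne']
  have hzρ : ρ ≤ |z - 1| := by
    by_contra! hlt
    have := hc (x := z) (by rwa [Real.dist_eq])
    rw [hzs, Real.dist_eq, one_pow, mul_one] at this
    linarith
  have : ρ ^ 2 ≤ (z - 1) ^ 2 := by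
    rw [← sq_abs (z - 1)]
    gcongr
  gcongr

end Potential

/-! ### Nonexistence of positive solutions -/

theorem firstDirichletEigenvalue_nonneg {N : ℕ} (Ω : Opens (EuclideanSpace ℝ (Fin N))) :
    0 ≤ firstDirichletEigenvalue Ω := by
  refine Real.sInf_nonneg ?_
  rintro r ⟨v, G, -, -, rfl⟩
  positivity

theorem theorem1p4 (N : ℕ) (hN : 3 ≤ N)
    (Ω : TopologicalSpace.Opens (EuclideanSpace ℝ (Fin N)))
    (hΩ_conn : IsConnected (Ω : Set (EuclideanSpace ℝ (Fin N))))
    (hΩ_bdd : Bornology.IsBounded (Ω : Set (EuclideanSpace ℝ (Fin N))))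
    (lam mu : ℝ) (hmu : mu < 0)
    (h : 0 ≤ -(((N : ℝ) - 2) * mu / 2)
        + ((N : ℝ) - 2) * mu / 2 * Real.log (-(((N : ℝ) - 2) * mu / 2))
        + lam - firstDirichletEigenvalue Ω) :
    ¬ ∃ u : EuclideanSpace ℝ (Fin N) → ℝ, IsPositiveSolution Ω lam mu u := by
  rintro ⟨u, ⟨w, hu, hsol⟩, hpos⟩
  have hN' : (3 : ℝ) ≤ N := by exact_mod_cast hN
  obtain ⟨a, ha⟩ : ∃ a, a = -(((N : ℝ) - 2) * mu / 2) := ⟨_, rfl⟩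
  have ha0 : 0 < a := by rw [ha]; nlinarith
  have hΛ : firstDirichletEigenvalue Ω ≤ a - a * Real.log a + lam := by
    rw [← ha, show ((N : ℝ) - 2) * mu / 2 = -a by rw [ha, neg_neg]] at h
    linarith
  have : IsFiniteMeasure (volume.restrict (Ω : Set (EuclideanSpace ℝ (Fin N)))) :=
    ⟨by simpa using hΩ_bdd.measure_lt_top⟩
  have hum := hu.memLp.1
  have hVm : AEStronglyMeasurable (fun x => logCriticalPotential N lam mu (u x))
      (volume.restrict Ω) :=
    (measurable_logCriticalPotential.comp_aemeasurable hum.aemeasurable).aestronglyMeasurable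
  have hVu : Integrable (fun x => logCriticalPotential N lam mu (u x) * u x)
      (volume.restrict Ω) := by
    have hq0 : 0 < criticalExponent N := div_pos (by linarith) (by linarith)
    have hq := (hu.memLp_criticalExponent hN).integrable_norm_rpow (by simpa using hq0) (by simp)
    rw [ENNReal.toReal_ofReal hq0.le] at hq
    have h1 : Integrable u (volume.restrict Ω) := hu.memLp.integrable (by norm_num)
    have hb := (((integrable_const (μ := volume.restrict (Ω : Set (EuclideanSpace ℝ (Fin N))))
      (1 : ℝ)).add hq).add (h1.const_mul |lam|)).add
      ((((integrable_const (1 : ℝ)).add hu.memLp.integrable_sq).const_mul 2).const_mul |mu|)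
    refine hb.mono' (hVm.mul hum) ?_
    filter_upwards [hpos] with x hx
    have h2 := abs_logCriticalPotential_mul_le (lam := lam) (mu := mu) hN hx
    simpa [abs_of_pos hx] using h2
  have hsol' : ∀ φ : 𝓓(Ω, ℝ), ∫ x in Ω, inner ℝ (w x) (gradient φ x) =
      ∫ x in Ω, logCriticalPotential N lam mu (u x) * u x * φ x := fun φ => by
    rw [hsol φ]
    refine integral_congr_ae ?_
    filter_upwards [hpos] with x hx
    rw [logCriticalNonlinearity_eq hx]
  obtain ⟨κ, hκ, hgap⟩ := hu.exists_gap (by omega) hΩ_bdd hpos hVm hVu hsol'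
    (firstDirichletEigenvalue_nonneg Ω) (Real.rpow_pos_of_pos ha0 (criticalExponent N - 2)⁻¹)
    (by
      filter_upwards [hpos] with x hx
      have h1 := add_le_logCriticalPotential (lam := lam) hN hmu ha hx
      have h2 : 0 ≤ a * (√(u x ^ (criticalExponent N - 2) / a) - 1) ^ 2 := by positivity
      linarith)
    (fun δ hδ => by
      obtain ⟨ε, hε, h1⟩ := exists_add_le_logCriticalPotential (lam := lam) hN hmu ha hδ
      refine ⟨ε, hε, ?_⟩
      filter_upwards [hpos] with x hx hfar
      linarith [h1 (u x) hx hfar])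
  have hc0 : 0 ≤ firstDirichletEigenvalue Ω + κ :=
    add_nonneg (firstDirichletEigenvalue_nonneg Ω) hκ.le
  have hne : ¬ (u =ᵐ[volume.restrict Ω] 0) := fun h0 => by
    have h1 : ∀ᵐ x ∂(volume.restrict (Ω : Set (EuclideanSpace ℝ (Fin N)))), False := by
      filter_upwards [hpos, h0] with x hx hx0
      exact hx.ne' hx0
    have h2 : volume (Ω : Set (EuclideanSpace ℝ (Fin N))) = 0 := by simpa [ae_iff] using h1
    exact (Ω.isOpen.measure_pos volume hΩ_conn.nonempty).ne' h2
  have hle : firstDirichletEigenvalue Ω + κ ≤ firstDirichletEigenvalue Ω := by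
    refine le_csInf ⟨_, u, w, hu, hne, rfl⟩ ?_
    rintro r ⟨v, G, hv, hv0, rfl⟩
    have hM : 0 < ∫ x in Ω, v x ^ 2 := by
      refine lt_of_le_of_ne (integral_nonneg fun x => sq_nonneg _) fun h0 => hv0 ?_
      have h1 := (integral_eq_zero_iff_of_nonneg (fun x => sq_nonneg (v x))
        hv.memLp.integrable_sq).mp h0.symm
      filter_upwards [h1] with x hx
      simpa using hx
    rw [le_div_iff₀ hM]
    exact hv.mul_integral_sq_le hc0 hgap
  linarith
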